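/- Let $m$ be Lebesgue measure on $[0,1]$, let $\Lambda=(\lambda_n)_{n\ge 1}$ be a strictly increasing sequence of positive real numbers with $\sum_n 1/\lambda_n<\infty$, and let $M^1_\Lambda$ be the closed linear span of the functions $x^{\lambda_n}$ in $L^1(m)$ (real or complex scalars); its elements are identified with their representatives that are continuous on $[0,1)$. For $\epsilon\in(0,1]$ let $c_\epsilon$ be the smallest constant such that $$\sup_{0\le t\le 1-\epsilon}|f(t)|\le c_\epsilon\int_{1-\epsilon}^1|f(x)|\,dx\qquad\text{for all } f\in M^1_\Lambda .$$ Let $c:(0,1]\to\mathbb R$ be a continuous decreasing (not necessarily strictly) function with $c(\epsilon)\ge c_\epsilon$ for all $\epsilon\in(0,1]$, and put $\kappa(t)=c(1-t)$ for $t\in[0,1)$. Let $\mu$ be a finite positive Borel measure on $[0,1]$ with $\mu(\{1\})=0$. If $\kappa\in L^1(\mu)$, then $\mu$ is $\Lambda$-embedding, that is, there is a constant $C>0$ with $\|p\|_{L^1(\mu)}\le C\|p\|_{L^1(m)}$ for all finite linear combinations $p$ of the functions $x^{\lambda_n}$. Moreover $M^1_\Lambda\subset L^1(\mu)$, and the embedding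 operator $\iota_\mu:M^1_\Lambda\to L^1(\mu)$, $f\mapsto f$, is bounded with $\|\iota_\mu\|\le\|\kappa\|_{L^1(\mu)}$. -/

import Mathlib

open MeasureTheory
open scoped ENNReal unitInterval

noncomputable section

/-- The Müntz polynomials: the finite linear combinations of the monomials `x ^ (Λ n)`, as
continuous functions on `[0, 1]` (the exponents are meant to be positive). -/
def muntzPoly (𝕜 : Type*) [RCLike 𝕜] (Λ : ℕ → ℝ) : Submodule 𝕜 C(I, 𝕜) :=
  Submodule.span 𝕜 {p : C(I, 𝕜) | ∃ n : ℕ, ∀ t : I, p t = (((t : ℝ) ^ (Λ n) : ℝ) : 𝕜)}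

/-- The Müntz space: the closed linear span of the monomials `x ^ (Λ n)` in `L¹(m)`, where `m` is
the Lebesgue measure on `[0, 1]`. -/
def muntzSpace (𝕜 : Type*) [RCLike 𝕜] (Λ : ℕ → ℝ) :
    Submodule 𝕜 (Lp 𝕜 1 (volume : Measure I)) :=
  ((muntzPoly 𝕜 Λ).map
    (ContinuousMap.toLp (E := 𝕜) 1 (volume : Measure I) 𝕜).toLinearMap).topologicalClosure

/-- `f` is a representative of the class `F` in `L¹(m)` that is continuous on `[0, 1)`.
The values of such an `f` on `[0, 1)` are determined by `F`. -/
def IsContRep {𝕜 : Type*} [RCLike 𝕜] (f : I → 𝕜) (F : Lp 𝕜 1 (volume : Measure I)) : Prop :=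
  ContinuousOn f {t : I | t < 1} ∧ f =ᵐ[volume] F

/-- The smallest constant `C` such that `sup_{0 ≤ t ≤ 1 - ε} |f t| ≤ C * ∫_{1 - ε}^1 |f|` for all
functions `f` in the Müntz space; its value is `∞` if there is no finite one. -/
def beConst (𝕜 : Type*) [RCLike 𝕜] (Λ : ℕ → ℝ) (ε : ℝ) : ℝ≥0∞ :=
  sInf {C : ℝ≥0∞ | ∀ F ∈ muntzSpace 𝕜 Λ, ∀ f : I → 𝕜, IsContRep f F →
    (⨆ t ∈ {t : I | (t : ℝ) ≤ 1 - ε}, ‖f t‖ₑ) ≤ C * ∫⁻ x in {x : I | 1 - ε ≤ (x : ℝ)}, ‖f x‖ₑ}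

/-- `μ` is a `Λ`-embedding measure: for some `C > 0`, `‖p‖_{L¹(μ)} ≤ C * ‖p‖_{L¹(m)}` for all
Müntz polynomials `p`. -/
def IsLambdaEmbedding (𝕜 : Type*) [RCLike 𝕜] (Λ : ℕ → ℝ) (μ : Measure I) : Prop :=
  ∃ C : ℝ, 0 < C ∧ ∀ p ∈ muntzPoly 𝕜 Λ,
    eLpNorm p 1 μ ≤ ENNReal.ofReal C * eLpNorm p 1 (volume : Measure I)

/-- `ι` is the inclusion of the Müntz space in `L¹(μ)`: it sends each `F` to the class in `L¹(μ)` of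
the representative of `F` that is continuous on `[0, 1)`. If `μ {1} = 0`, there is at most one
such `ι`. -/
def IsEmbeddingOperator {𝕜 : Type*} [RCLike 𝕜] {Λ : ℕ → ℝ} {μ : Measure I}
    (ι : muntzSpace 𝕜 Λ →L[𝕜] Lp 𝕜 1 μ) : Prop :=
  ∀ F : muntzSpace 𝕜 Λ, ∃ f : I → 𝕜, IsContRep f (F : Lp 𝕜 1 (volume : Measure I)) ∧ ι F =ᵐ[μ] f

end

open Filter Topology

section

variable {𝕜 : Type*} [RCLike 𝕜] {Λ : ℕ → ℝ}

/-! For `t < 1`, the defining inequality of `beConst` with `ε = 1 - t`, read at the endpoint `t`,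
gives `|f t| ≤ κ t * ‖f‖₁`. Integrating in `t` against `μ`, which does not charge `1`, gives the
norm bound. The same pointwise bound, applied to differences, makes approximating polynomials
uniformly Cauchy on each `[0, s]` with `s < 1`. This yields the continuous representative
(`exists_isContRep`), and its uniqueness makes the embedding well defined and linear. -/

lemma IsContRep.sub {f g : I → 𝕜} {F G : Lp 𝕜 1 (volume : Measure I)}
    (hf : IsContRep f F) (hg : IsContRep g G) : IsContRep (f - g) (F - G) :=
  ⟨hf.1.sub hg.1, (hf.2.sub hg.2).trans (Lp.coeFn_sub F G).symm⟩

lemma IsContRep.add {f g : I → 𝕜} {F G : Lp 𝕜 1 (volume : Measure I)}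
    (hf : IsContRep f F) (hg : IsContRep g G) : IsContRep (f + g) (F + G) :=
  ⟨hf.1.add hg.1, (hf.2.add hg.2).trans (Lp.coeFn_add F G).symm⟩

lemma IsContRep.const_smul {f : I → 𝕜} {F : Lp 𝕜 1 (volume : Measure I)}
    (hf : IsContRep f F) (a : 𝕜) : IsContRep (a • f) (a • F) :=
  ⟨hf.1.const_smul a, (hf.2.const_smul a).trans (Lp.coeFn_smul a F).symm⟩

lemma isContRep_toLp (p : C(I, 𝕜)) :
    IsContRep p (ContinuousMap.toLp (E := 𝕜) 1 (volume : Measure I) 𝕜 p) :=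
  ⟨p.continuous.continuousOn, (ContinuousMap.coeFn_toLp (𝕜 := 𝕜) volume p).symm⟩

lemma toLp_mem_muntzSpace {p : C(I, 𝕜)} (hp : p ∈ muntzPoly 𝕜 Λ) :
    ContinuousMap.toLp (E := 𝕜) 1 (volume : Measure I) 𝕜 p ∈ muntzSpace 𝕜 Λ :=
  Submodule.le_topologicalClosure _ (Submodule.mem_map_of_mem hp)

lemma IsContRep.lintegral_enorm {f : I → 𝕜} {F : Lp 𝕜 1 (volume : Measure I)}
    (hf : IsContRep f F) : ∫⁻ x, ‖f x‖ₑ = ‖F‖ₑ := by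
  rw [Lp.enorm_def, ← eLpNorm_one_eq_lintegral_enorm, eLpNorm_congr_ae hf.2]

/-- The infimum defining `beConst` is attained. -/
lemma IsContRep.enorm_le_beConst_mul {s : I} (hs : beConst 𝕜 Λ (1 - s) ≠ ∞)
    {f : I → 𝕜} {F : Lp 𝕜 1 (volume : Measure I)} (hF : F ∈ muntzSpace 𝕜 Λ)
    (hf : IsContRep f F) {t : I} (ht : t ≤ s) :
    ‖f t‖ₑ ≤ beConst 𝕜 Λ (1 - s) * ‖F‖ₑ := by
  refine ENNReal.le_of_forall_pos_le_add fun δ hδ _ => ?_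
  -- If `‖F‖ₑ = 0`, then `η = ∞` and the product is still `0`.
  obtain ⟨η, hη, hηδ⟩ : ∃ η : ℝ≥0∞, 0 < η ∧ η * ‖F‖ₑ ≤ δ := by
    refine ⟨δ / ‖F‖ₑ, ENNReal.div_pos (by exact_mod_cast hδ.ne') enorm_ne_top, ?_⟩
    exact ENNReal.mul_le_of_le_div le_rfl
  obtain ⟨C, hC, hlt⟩ := sInf_lt_iff.1 (ENNReal.lt_add_right hs hη.ne')
  calc ‖f t‖ₑ ≤ ⨆ t ∈ {t : I | (t : ℝ) ≤ 1 - (1 - s)}, ‖f t‖ₑ :=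
        le_iSup₂_of_le t (by simpa using ht) le_rfl
    _ ≤ C * ∫⁻ x in {x : I | 1 - (1 - (s : ℝ)) ≤ (x : ℝ)}, ‖f x‖ₑ := hC F hF f hf
    _ ≤ C * ‖F‖ₑ := by
        rw [← hf.lintegral_enorm]
        gcongr
        exact Measure.restrict_le_self
    _ ≤ (beConst 𝕜 Λ (1 - s) + η) * ‖F‖ₑ := by gcongr; exact hlt.le
    _ ≤ beConst 𝕜 Λ (1 - s) * ‖F‖ₑ + δ := by rw [add_mul]; gcongr

/-- If all Bernstein-type constants are finite, then each element of the Müntz space has a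
representative that is continuous on `[0, 1)`. -/
lemma exists_isContRep (hfin : ∀ s : I, s < 1 → beConst 𝕜 Λ (1 - s) ≠ ∞)
    {F : Lp 𝕜 1 (volume : Measure I)} (hF : F ∈ muntzSpace 𝕜 Λ) :
    ∃ f : I → 𝕜, IsContRep f F := by
  obtain ⟨P, hP, hPF⟩ := mem_closure_iff_seq_limit.1 hF
  choose p hp hpP using hP
  have hrep n : IsContRep (p n) (P n) := hpP n ▸ isContRep_toLp (p n)
  have hmem n : P n ∈ muntzSpace 𝕜 Λ := hpP n ▸ toLp_mem_muntzSpace (hp n)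
  have hcauchy : ∀ s : I, s < 1 → UniformCauchySeqOn (fun n t => p n t) atTop {t | t ≤ s} := by
    intro s hs
    rw [Metric.uniformCauchySeqOn_iff]
    intro δ hδ
    -- The `+ 1` keeps the denominator positive when the constant is `0`.
    obtain ⟨N, hN⟩ := Metric.cauchySeq_iff.1 hPF.cauchySeq
      (δ / ((beConst 𝕜 Λ (1 - s)).toReal + 1)) (by positivity)
    refine ⟨N, fun m hm n hn t ht => ?_⟩
    have h := ((hrep m).sub (hrep n)).enorm_le_beConst_mul (hfin s hs)
      (sub_mem (hmem m) (hmem n)) ht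
    have h' : ‖p m t - p n t‖ ≤ (beConst 𝕜 Λ (1 - s)).toReal * ‖P m - P n‖ := by
      have := ENNReal.toReal_mono (ENNReal.mul_ne_top (hfin s hs) enorm_ne_top) h
      simpa using this
    have hd := hN m hm n hn
    rw [dist_eq_norm, lt_div_iff₀ (by positivity)] at hd
    rw [dist_eq_norm]
    nlinarith [norm_nonneg (P m - P n)]
  have hlim : ∀ t : I, ∃ y : 𝕜, t < 1 → Tendsto (fun n => p n t) atTop (𝓝 y) := by
    intro t
    by_cases ht : t < 1
    · obtain ⟨y, hy⟩ := cauchySeq_tendsto_of_complete ((hcauchy t ht).cauchySeq (x := t) (le_refl t))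
      exact ⟨y, fun _ => hy⟩
    · exact ⟨0, fun h => absurd h ht⟩
  choose f hf using hlim
  refine ⟨f, fun t ht => ?_, ?_⟩
  · obtain ⟨s, hts, hs⟩ := exists_between (show t < 1 from ht)
    have hunif := (hcauchy s hs).tendstoUniformlyOn_of_tendsto
      fun u hu => hf u (lt_of_le_of_lt hu hs)
    have hc := hunif.continuousOn
      (Eventually.frequently (Eventually.of_forall fun n => (p n).continuous.continuousOn))
    exact (hc.continuousAt (Iic_mem_nhds hts)).continuousWithinAt
  -- A subsequence converges a.e. to `F`, and pointwise to `f` off `1`.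
  · obtain ⟨ns, hns, hae⟩ := (tendstoInMeasure_of_tendsto_Lp hPF).exists_seq_tendsto_ae
    have hone : ∀ᵐ t : I, t ≠ 1 := by simp [ae_iff]
    filter_upwards [hae, hone, ae_all_iff.2 fun n => (hrep n).2] with t h1 h2 h3
    refine tendsto_nhds_unique ?_ h1
    simp only [← h3]
    exact (hf t (lt_of_le_of_ne le_top h2)).comp hns.tendsto_atTop

lemma IsContRep.aestronglyMeasurable {μ : Measure I} (hμ : μ {1} = 0) {f : I → 𝕜}
    {F : Lp 𝕜 1 (volume : Measure I)} (hf : IsContRep f F) : AEStronglyMeasurable f μ := by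
  have h := hf.1.aestronglyMeasurable (μ := μ) (measurableSet_Iio (a := (1 : I)))
  rwa [Measure.restrict_eq_self_of_ae_mem] at h
  have hone : ∀ᵐ t ∂μ, t ≠ 1 := by simpa [ae_iff] using hμ
  filter_upwards [hone] with t ht using lt_of_le_of_ne le_top ht

lemma IsContRep.eLpNorm_le {μ : Measure I} (hμ : μ {1} = 0) {κ : I → ℝ}
    (hκ : ∀ t : I, t < 1 → beConst 𝕜 Λ (1 - t) ≤ ENNReal.ofReal (κ t))
    (hint : Integrable κ μ) {f : I → 𝕜} {F : Lp 𝕜 1 (volume : Measure I)}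
    (hF : F ∈ muntzSpace 𝕜 Λ) (hf : IsContRep f F) :
    eLpNorm f 1 μ ≤ ENNReal.ofReal (∫ t, ‖κ t‖ ∂μ) * ‖F‖ₑ := by
  have hone : ∀ᵐ t ∂μ, t ≠ 1 := by simpa [ae_iff] using hμ
  rw [eLpNorm_one_eq_lintegral_enorm, ofReal_integral_norm_eq_lintegral_enorm hint,
    ← lintegral_mul_const' _ _ enorm_ne_top]
  refine lintegral_mono_ae ?_
  filter_upwards [hone] with t ht
  have ht1 : t < 1 := lt_of_le_of_ne le_top ht
  refine (hf.enorm_le_beConst_mul (ne_top_of_le_ne_top ENNReal.ofReal_ne_top (hκ t ht1)) hF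
    le_rfl).trans ?_
  gcongr
  exact (hκ t ht1).trans (Real.ofReal_le_enorm _)

/-- `f - g` represents the class `0`, so the pointwise bound forces it to vanish on `[0, 1)`, which
carries `μ`. -/
lemma IsContRep.ae_eq {μ : Measure I} (hμ : μ {1} = 0)
    (hfin : ∀ s : I, s < 1 → beConst 𝕜 Λ (1 - s) ≠ ∞)
    {f g : I → 𝕜} {F : Lp 𝕜 1 (volume : Measure I)}
    (hf : IsContRep f F) (hg : IsContRep g F) : f =ᵐ[μ] g := by
  have hone : ∀ᵐ t ∂μ, t ≠ 1 := by simpa [ae_iff] using hμ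
  filter_upwards [hone] with t ht
  have h := (hf.sub hg).enorm_le_beConst_mul (Λ := Λ) (t := t)
    (hfin t (lt_of_le_of_ne le_top ht)) (by simp) le_rfl
  simpa [sub_eq_zero] using h

end

theorem mainTheorem5 {𝕜 : Type*} [RCLike 𝕜]
    (Λ : ℕ → ℝ) (hpos : ∀ n, 0 < Λ n) (hmono : StrictMono Λ)
    (hsum : Summable fun n => 1 / Λ n)
    (μ : Measure I) [IsFiniteMeasure μ] (hμ : μ {1} = 0)
    (c : ℝ → ℝ) (hcont : ContinuousOn c (Set.Ioc 0 1)) (hanti : AntitoneOn c (Set.Ioc 0 1))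
    (hmaj : ∀ ε ∈ Set.Ioc (0 : ℝ) 1, beConst 𝕜 Λ ε ≤ ENNReal.ofReal (c ε))
    (κ : I → ℝ) (hκ : ∀ t : I, t < 1 → κ t = c (1 - t))
    (hint : Integrable κ μ) :
    IsLambdaEmbedding 𝕜 Λ μ ∧
      ∃ ι : muntzSpace 𝕜 Λ →L[𝕜] Lp 𝕜 1 μ,
        IsEmbeddingOperator ι ∧ ‖ι‖ ≤ ∫ t, ‖κ t‖ ∂μ := by
  have hK : ∀ t : I, t < 1 → beConst 𝕜 Λ (1 - t) ≤ ENNReal.ofReal (κ t) := fun t ht => by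
    rw [hκ t ht]
    exact hmaj _ ⟨sub_pos.2 ht, sub_le_self _ t.2.1⟩
  have hfin : ∀ t : I, t < 1 → beConst 𝕜 Λ (1 - t) ≠ ∞ := fun t ht =>
    ne_top_of_le_ne_top ENNReal.ofReal_ne_top (hK t ht)
  have hnn : 0 ≤ ∫ t, ‖κ t‖ ∂μ := integral_nonneg fun t => norm_nonneg _
  constructor
  -- The integral may vanish, and `C` must be positive.
  · refine ⟨(∫ t, ‖κ t‖ ∂μ) + 1, by positivity, fun p hp => ?_⟩
    have hrep := isContRep_toLp p
    refine (hrep.eLpNorm_le hμ hK hint (toLp_mem_muntzSpace hp)).trans ?_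
    rw [← hrep.lintegral_enorm, ← eLpNorm_one_eq_lintegral_enorm]
    gcongr
    linarith
  · choose f hf using fun F : muntzSpace 𝕜 Λ => exists_isContRep hfin F.2
    have hLp F : MemLp (f F) 1 μ := ⟨(hf F).aestronglyMeasurable hμ,
      ((hf F).eLpNorm_le hμ hK hint F.2).trans_lt
        (ENNReal.mul_lt_top ENNReal.ofReal_lt_top enorm_lt_top)⟩
    -- The chosen representatives need not depend linearly on `F`; their classes in `L¹(μ)` do.
    let L : muntzSpace 𝕜 Λ →ₗ[𝕜] Lp 𝕜 1 μ :=
      { toFun F := (hLp F).toLp (f F)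
        map_add' F G := by
          rw [← MemLp.toLp_add]
          exact MemLp.toLp_congr _ _ ((hf (F + G)).ae_eq hμ hfin ((hf F).add (hf G)))
        map_smul' a F := by
          rw [RingHom.id_apply, ← MemLp.toLp_const_smul]
          exact MemLp.toLp_congr _ _ ((hf (a • F)).ae_eq hμ hfin ((hf F).const_smul a)) }
    have hL F : ‖L F‖ ≤ (∫ t, ‖κ t‖ ∂μ) * ‖F‖ := by
      have h := ENNReal.toReal_mono (ENNReal.mul_ne_top ENNReal.ofReal_ne_top enorm_ne_top)
        ((hf F).eLpNorm_le hμ hK hint F.2)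
      rw [ENNReal.toReal_mul, ENNReal.toReal_ofReal hnn, toReal_enorm] at h
      exact (Lp.norm_toLp _ (hLp F)).trans_le h
    exact ⟨L.mkContinuous _ hL, fun F => ⟨f F, hf F, (hLp F).coeFn_toLp⟩,
      L.mkContinuous_norm_le hnn hL⟩
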